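/- Equip $\mathbb{R}^3$ with the standard contact structure $\xi_{std}=\ker(dz-y\,dx)$. An (oriented) Legendrian knot is a smooth embedding of the oriented circle into $\mathbb{R}^3$ that is everywhere tangent to $\xi_{std}$. A front diagram $D$ of a Legendrian knot $K$ is the projection to the $(x,z)$-plane of a Legendrian knot Legendrian isotopic to $K$ (for instance $K$ itself) whose projection is generic: its only singularities are semicubical cusps and transverse double points, no cusp lies on another strand, and there are no triple points. At a crossing, the overcrossing strand is the one of smaller slope. A cusp is an up (down) cusp if the curve traverses it upwards (downwards). The Thurston–Bennequin number and the rotation number of $K$ are read from $D$ by $$tb(K)=w(D)-\tfrac12\,\#\{\text{cusps of }D\},\qquad rot(K)=\tfrac12\bigl(\#\{\text{down cusps of } D\}-\#\{\text{up cusps of } D\}\bigr),$$ where $w(D)$ is the writhe, the sum of the signs of the crossings. A GL-rack $(X,*,u,d)$ is a set $X$ with a binary operation $*$ such that every map $y\mapsto y*x$ is bijective and $(x*y)*z=(x*z)*(y*z)$, together with maps $u,d:X\to X$ such that $ud(x*x)=du(x*x)=x$, $u(x*y)=u(x)*y$, $d(x*y)=d(x)*y$ and $x*u(y)=x*d(y)=x*y$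 for all $x,y,z\in X$. An isomorphism of GL-racks is a bijection compatible with $*$, $u$ and $d$. The fundamental GL-rack $GLR_K$ is the GL-rack presented as follows: the generators are the arcs of $D$, that is, the pieces into which its cusps and undercrossings cut the curve; at an up (down) cusp with arriving arc $a$ and departing arc $b$ there is the relation $b=u(a)$ (respectively $b=d(a)$); at a crossing with overcrossing arc $c$, and with undercrossing arcs $a$ on the right and $b$ on the left of the oriented strand $c$, there is the relation $b=a*c$. **Theorem.** Let $K_1$ and $K_2$ be Legendrian knots in $(\mathbb{R}^3,\xi_{std})$, with $tb$, $rot$ and the fundamental GL-rack of each read from any front diagram of it. If $GLR_{K_1}$ and $GLR_{K_2}$ are isomorphic, then either $tb(K_1)=tb(K_2)$ and $rot(K_1)=rot(K_2)$, or $tb(K_1)=-tb(K_2)$ and $rot(K_1)=-rot(K_2)$. -/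

import Mathlib

open scoped ContDiff Topology

/-! ### GL-racks

Mathlib's racks act on the left: `y ◃ x` is what is often written `x * y`. -/

/-- A generalized Legendrian rack (GL-rack). With `x * y := y ◃ x` the laws read
`ud(x * x) = du(x * x) = x`, `u(x * y) = u(x) * y`, `d(x * y) = d(x) * y`,
`x * u(y) = x * d(y) = x * y`. -/
class GLRack (X : Type*) extends Rack X where
  u : X → X
  d : X → X
  u_d_act_self : ∀ x : X, u (d (act x x)) = x
  d_u_act_self : ∀ x : X, d (u (act x x)) = x
  u_act : ∀ x y : X, u (act y x) = act y (u x)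
  d_act : ∀ x y : X, d (act y x) = act y (d x)
  act_u : ∀ x y : X, act (u y) x = act y x
  act_d : ∀ x y : X, act (d y) x = act y x

/-- An isomorphism of GL-racks: a bijection compatible with the rack operation, `u` and `d`. -/
structure GLRackIso (X Y : Type*) [GLRack X] [GLRack Y] extends X ≃ Y where
  map_act' : ∀ a b : X, toFun (Shelf.act a b) = Shelf.act (toFun a) (toFun b)
  map_u' : ∀ a : X, toFun (GLRack.u a) = GLRack.u (toFun a)
  map_d' : ∀ a : X, toFun (GLRack.d a) = GLRack.d (toFun a)

/-- Words in the generators `X`: `op a b` is `a * b` and `inv a b` is `a *⁻¹ b`. -/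
inductive GLWord (X : Type*) where
  | of : X → GLWord X
  | op : GLWord X → GLWord X → GLWord X
  | inv : GLWord X → GLWord X → GLWord X
  | u : GLWord X → GLWord X
  | d : GLWord X → GLWord X

/-- The congruence on words generated by the GL-rack laws and the relations `r`. -/
inductive GLCongr {X : Type*} (r : GLWord X → GLWord X → Prop) : GLWord X → GLWord X → Prop
  | rel {a b} : r a b → GLCongr r a b
  | refl (a) : GLCongr r a a
  | symm {a b} : GLCongr r a b → GLCongr r b a
  | trans {a b c} : GLCongr r a b → GLCongr r b c → GLCongr r a c
  | op_congr {a a' b b'} : GLCongr r a a' → GLCongr r b b' → GLCongr r (.op a b) (.op a' b')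
  | inv_congr {a a' b b'} : GLCongr r a a' → GLCongr r b b' → GLCongr r (.inv a b) (.inv a' b')
  | u_congr {a a'} : GLCongr r a a' → GLCongr r (.u a) (.u a')
  | d_congr {a a'} : GLCongr r a a' → GLCongr r (.d a) (.d a')
  | inv_op (a b) : GLCongr r (.inv (.op a b) b) a
  | op_inv (a b) : GLCongr r (.op (.inv a b) b) a
  | distrib (a b c) : GLCongr r (.op (.op a b) c) (.op (.op a c) (.op b c))
  | u_d (a) : GLCongr r (.u (.d (.op a a))) a
  | d_u (a) : GLCongr r (.d (.u (.op a a))) a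
  | u_op (a b) : GLCongr r (.u (.op a b)) (.op (.u a) b)
  | d_op (a b) : GLCongr r (.d (.op a b)) (.op (.d a) b)
  | op_u (a b) : GLCongr r (.op a (.u b)) (.op a b)
  | op_d (a b) : GLCongr r (.op a (.d b)) (.op a b)

/-- The congruence `GLCongr r` as a setoid. -/
def glSetoid {X : Type*} (r : GLWord X → GLWord X → Prop) : Setoid (GLWord X) where
  r := GLCongr r
  iseqv := ⟨.refl, .symm, .trans⟩

/-- The GL-rack presented by generators `X` and relations `r`, i.e. the free GL-rack on `X`
modulo `r`. -/
def PresentedGLRack {X : Type*} (r : GLWord X → GLWord X → Prop) : Type _ :=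
  Quotient (glSetoid r)

instance PresentedGLRack.instGLRack {X : Type*} (r : GLWord X → GLWord X → Prop) :
    GLRack (PresentedGLRack r) where
  act b a := Quotient.map₂ (sa := glSetoid r) (sb := glSetoid r) (sc := glSetoid r)
    GLWord.op (fun _ _ h _ _ k => GLCongr.op_congr h k) a b
  invAct b a := Quotient.map₂ (sa := glSetoid r) (sb := glSetoid r) (sc := glSetoid r)
    GLWord.inv (fun _ _ h _ _ k => GLCongr.inv_congr h k) a b
  u := Quotient.map (sa := glSetoid r) (sb := glSetoid r) GLWord.u (fun _ _ h => GLCongr.u_congr h)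
  d := Quotient.map (sa := glSetoid r) (sb := glSetoid r) GLWord.d (fun _ _ h => GLCongr.d_congr h)
  self_distrib := by
    rintro ⟨a⟩ ⟨b⟩ ⟨c⟩
    exact Quotient.sound (s := glSetoid r) (GLCongr.distrib c b a)
  left_inv := by
    rintro ⟨a⟩ ⟨b⟩
    exact Quotient.sound (s := glSetoid r) (GLCongr.inv_op b a)
  right_inv := by
    rintro ⟨a⟩ ⟨b⟩
    exact Quotient.sound (s := glSetoid r) (GLCongr.op_inv b a)
  u_d_act_self := by
    rintro ⟨a⟩
    exact Quotient.sound (s := glSetoid r) (GLCongr.u_d a)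
  d_u_act_self := by
    rintro ⟨a⟩
    exact Quotient.sound (s := glSetoid r) (GLCongr.d_u a)
  u_act := by
    rintro ⟨a⟩ ⟨b⟩
    exact Quotient.sound (s := glSetoid r) (GLCongr.u_op a b)
  d_act := by
    rintro ⟨a⟩ ⟨b⟩
    exact Quotient.sound (s := glSetoid r) (GLCongr.d_op a b)
  act_u := by
    rintro ⟨a⟩ ⟨b⟩
    exact Quotient.sound (s := glSetoid r) (GLCongr.op_u a b)
  act_d := by
    rintro ⟨a⟩ ⟨b⟩
    exact Quotient.sound (s := glSetoid r) (GLCongr.op_d a b)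

/-! ### Legendrian knots -/

/-- An oriented Legendrian knot in `ℝ³` with the contact structure `ker (dz - y dx)`: a smooth
embedding of the circle `ℝ / ℤ`, given by its `1`-periodic coordinate functions and oriented by
its parametrization. -/
structure LegendrianKnot where
  x : ℝ → ℝ
  y : ℝ → ℝ
  z : ℝ → ℝ
  smooth_x : ContDiff ℝ ∞ x
  smooth_y : ContDiff ℝ ∞ y
  smooth_z : ContDiff ℝ ∞ z
  periodic_x : Function.Periodic x 1
  periodic_y : Function.Periodic y 1
  periodic_z : Function.Periodic z 1
  immersed : ∀ t, ¬ (deriv x t = 0 ∧ deriv y t = 0 ∧ deriv z t = 0)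
  injective : ∀ s t, x s = x t → y s = y t → z s = z t → ∃ n : ℤ, s = t + n
  legendrian : ∀ t, deriv z t = y t * deriv x t

/-- Legendrian isotopy: a smooth family of Legendrian knots joining `K` to `K'`. -/
def LegendrianIsotopic (K K' : LegendrianKnot) : Prop :=
  ∃ H : ℝ → LegendrianKnot, H 0 = K ∧ H 1 = K' ∧
    ContDiffOn ℝ ∞ (fun p : ℝ × ℝ => ((H p.1).x p.2, (H p.1).y p.2, (H p.1).z p.2))
      (Set.Icc 0 1 ×ˢ Set.univ)

namespace LegendrianKnot

variable (K : LegendrianKnot)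

/-! ### The front projection `t ↦ (x t, z t)` -/

/-- The front has a cusp at time `t`: its velocity vanishes (`z' = y x'`). -/
def IsCusp (t : ℝ) : Prop := deriv K.x t = 0

/-- The front is generic: its cusps are semicubical and lie on no other strand, and it has no
triple points. (By the Legendrian condition, strands through a double point of the front that is
not a cusp have the distinct slopes `y`, so such double points are transverse.) -/
structure HasGenericFront : Prop where
  cusp_nondegenerate : ∀ t, K.IsCusp t → deriv (deriv K.x) t ≠ 0
  cusp_not_double : ∀ s t, K.IsCusp t → K.x s = K.x t → K.z s = K.z t → ∃ n : ℤ, s = t + n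
  no_triple : ∀ r s t, K.x r = K.x s → K.z r = K.z s → K.x s = K.x t → K.z s = K.z t →
    (∃ n : ℤ, r = s + n) ∨ (∃ n : ℤ, s = t + n) ∨ (∃ n : ℤ, r = t + n)

/-- Up cusp: the curve passes upwards from the lower to the upper branch of the cusp. At a cusp,
`z(t+h) - z(t) - y(t) (x(t+h) - x(t)) = y'(t) x''(t) h³/3 + o(h³)` compares the front with its
tangent line at the cusp. -/
def IsUpCusp (t : ℝ) : Prop := K.IsCusp t ∧ 0 < deriv K.y t * deriv (deriv K.x) t

/-- Down cusp: the curve passes downwards from the upper to the lower branch of the cusp. -/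
def IsDownCusp (t : ℝ) : Prop := K.IsCusp t ∧ deriv K.y t * deriv (deriv K.x) t < 0

/-- The strands at times `t` and `s` cross in the front, the strand at `t` passing under the one
at `s`: the overcrossing strand is the one of smaller slope `y`. -/
def PassesUnder (t s : ℝ) : Prop := K.x t = K.x s ∧ K.z t = K.z s ∧ K.y s < K.y t

/-- The cross product of the front velocities of the overcrossing strand, at time `s`, and the
undercrossing strand, at time `t`. It is positive iff the undercrossing strand passes from the
right to the left of the overcrossing strand, that is, iff the crossing is positive. -/
noncomputable def velocityCross (t s : ℝ) : ℝ :=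
  deriv K.x s * deriv K.z t - deriv K.z s * deriv K.x t

/-- The crossings of the front, as pairs (undercrossing time, overcrossing time). -/
def crossings : Set (ℝ × ℝ) :=
  {p | p.1 ∈ Set.Ico (0 : ℝ) 1 ∧ p.2 ∈ Set.Ico (0 : ℝ) 1 ∧ K.PassesUnder p.1 p.2}

/-- The writhe of the front: the sum of the signs of its crossings. -/
noncomputable def writhe : ℤ :=
  ∑ᶠ p ∈ K.crossings, ((SignType.sign (K.velocityCross p.1 p.2) : SignType) : ℤ)

/-- The number of up cusps. -/
noncomputable def numUpCusps : ℕ := {t ∈ Set.Ico (0 : ℝ) 1 | K.IsUpCusp t}.ncard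

/-- The number of down cusps. -/
noncomputable def numDownCusps : ℕ := {t ∈ Set.Ico (0 : ℝ) 1 | K.IsDownCusp t}.ncard

/-- The number of cusps. -/
noncomputable def numCusps : ℕ := {t ∈ Set.Ico (0 : ℝ) 1 | K.IsCusp t}.ncard

/-! ### The fundamental GL-rack of the front -/

/-- The times at which the arcs of the front end: cusps and undercrossings. -/
def breaks : Set ℝ := {t | K.IsCusp t ∨ ∃ s, K.PassesUnder t s}

/-- Two times lie on the same arc if, modulo the period, they bound a segment of the curve
without cusps and undercrossings. -/
def SameArc (s t : {t : ℝ // t ∉ K.breaks}) : Prop :=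
  ∃ n : ℤ, Disjoint (Set.uIcc (s : ℝ) ((t : ℝ) + n)) K.breaks

/-- The arcs of the front: its pieces between consecutive cusps or undercrossings. -/
def Arc : Type := Quot K.SameArc

/-- The arc containing the point at time `t`. -/
def arc (t : {t : ℝ // t ∉ K.breaks}) : K.Arc := Quot.mk _ t

/-- `a` is the arc that arrives at time `t`. -/
def ArcBefore (t : ℝ) (a : K.Arc) : Prop :=
  ∀ᶠ s in 𝓝[<] t, ∃ h : s ∉ K.breaks, K.arc ⟨s, h⟩ = a

/-- `a` is the arc that departs at time `t`. -/
def ArcAfter (t : ℝ) (a : K.Arc) : Prop :=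
  ∀ᶠ s in 𝓝[>] t, ∃ h : s ∉ K.breaks, K.arc ⟨s, h⟩ = a

/-- The relations of the fundamental GL-rack. An up (down) cusp takes the arriving arc `a` to
`u(a)` (to `d(a)`). At a crossing with overcrossing arc `c`, the undercrossing arc on the left of
`c` is `a * c`, where `a` is the undercrossing arc on the right of `c`. -/
inductive FrontRel : GLWord K.Arc → GLWord K.Arc → Prop
  | upCusp {t : ℝ} {a b : K.Arc} : K.IsUpCusp t → K.ArcBefore t a → K.ArcAfter t b →
      FrontRel (.of b) (.u (.of a))
  | downCusp {t : ℝ} {a b : K.Arc} : K.IsDownCusp t → K.ArcBefore t a → K.ArcAfter t b →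
      FrontRel (.of b) (.d (.of a))
  | posCrossing {t s : ℝ} {a b : K.Arc} (hs : s ∉ K.breaks) : K.PassesUnder t s →
      0 < K.velocityCross t s → K.ArcBefore t a → K.ArcAfter t b →
      FrontRel (.of b) (.op (.of a) (.of (K.arc ⟨s, hs⟩)))
  | negCrossing {t s : ℝ} {a b : K.Arc} (hs : s ∉ K.breaks) : K.PassesUnder t s →
      K.velocityCross t s < 0 → K.ArcBefore t a → K.ArcAfter t b →
      FrontRel (.of a) (.op (.of b) (.of (K.arc ⟨s, hs⟩)))

/-- A front diagram of the Legendrian knot `K`: the front of a Legendrian knot that is Legendrian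
isotopic to `K` and has a generic front (for instance `K` itself, if its front is generic). -/
structure FrontDiagram where
  knot : LegendrianKnot
  isotopic : LegendrianIsotopic K knot
  generic : knot.HasGenericFront

end LegendrianKnot

namespace LegendrianKnot.FrontDiagram

variable {K : LegendrianKnot} (D : K.FrontDiagram)

/-- The Thurston-Bennequin number: the writhe minus half the number of cusps. -/
noncomputable def tb : ℚ := (D.knot.writhe : ℚ) - (D.knot.numCusps : ℚ) / 2

/-- The rotation number: half the difference of the numbers of down cusps and up cusps. -/
noncomputable def rot : ℚ := ((D.knot.numDownCusps : ℚ) - (D.knot.numUpCusps : ℚ)) / 2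

/-- The fundamental GL-rack, presented by the arcs of the front with one relation for each cusp
and each crossing. -/
abbrev GLR : Type := PresentedGLRack D.knot.FrontRel

end LegendrianKnot.FrontDiagram

/-! A homomorphism from the fundamental GL-rack to the translation GL-rack of an abelian group `A`
and `p, q : A` is a function on the arcs that jumps by `p` at up cusps, by `q` at down cusps, and
by `-(p + q)` and `p + q` under positive and negative crossings. Such a function exists iff the
jumps add up to `0` along the closed curve, that is, iff `(tb + rot) p + (tb - rot) q = 0`. For
`A = ℤ² / ⟨v₂⟩`, where `vᵢ = (tb(Kᵢ) + rot(Kᵢ), tb(Kᵢ) - rot(Kᵢ))`, and `p, q` the classes of the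
standard basis, it exists for `K₂`; composed with a homomorphism from the GL-rack of `K₁` to that
of `K₂` it yields `v₁ ∈ ℤ v₂`. By symmetry `v₂ ∈ ℤ v₁`, hence `v₁ = ± v₂`. -/

/-! ### Homomorphisms of GL-racks and presentations -/

/-- A homomorphism of GL-racks: a map compatible with the rack operation, `u` and `d`. -/
structure GLRackHom (X Y : Type*) [GLRack X] [GLRack Y] extends ShelfHom X Y where
  map_u' : ∀ a : X, toFun (GLRack.u a) = GLRack.u (toFun a)
  map_d' : ∀ a : X, toFun (GLRack.d a) = GLRack.d (toFun a)

namespace GLRackHom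

variable {X Y Z : Type*} [GLRack X] [GLRack Y] [GLRack Z]

instance : FunLike (GLRackHom X Y) X Y where
  coe φ := φ.toFun
  coe_injective := by
    rintro ⟨⟨f, _⟩, _, _⟩ ⟨⟨g, _⟩, _, _⟩ (rfl : f = g)
    rfl

theorem map_act (φ : GLRackHom X Y) (a b : X) : φ (Shelf.act a b) = Shelf.act (φ a) (φ b) :=
  φ.map_act'

theorem map_u (φ : GLRackHom X Y) (a : X) : φ (GLRack.u a) = GLRack.u (φ a) :=
  φ.map_u' a

theorem map_d (φ : GLRackHom X Y) (a : X) : φ (GLRack.d a) = GLRack.d (φ a) :=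
  φ.map_d' a

theorem map_invAct (φ : GLRackHom X Y) (a b : X) :
    φ (Rack.invAct a b) = Rack.invAct (φ a) (φ b) := by
  rw [← Rack.left_inv (φ a) (φ (Rack.invAct a b)), ← φ.map_act, Rack.right_inv]

/-- The composition of two homomorphisms of GL-racks. -/
def comp (ψ : GLRackHom Y Z) (φ : GLRackHom X Y) : GLRackHom X Z where
  toShelfHom := ψ.toShelfHom.comp φ.toShelfHom
  map_u' a := (congrArg ψ (φ.map_u a)).trans (ψ.map_u (φ a))
  map_d' a := (congrArg ψ (φ.map_d a)).trans (ψ.map_d (φ a))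

end GLRackHom

namespace GLRackIso

variable {X Y : Type*} [GLRack X] [GLRack Y]

/-- The homomorphism underlying an isomorphism of GL-racks. -/
def toHom (e : GLRackIso X Y) : GLRackHom X Y where
  toFun := e.toFun
  map_act' := e.map_act' _ _
  map_u' := e.map_u'
  map_d' := e.map_d'

/-- The inverse of an isomorphism of GL-racks. -/
def symm (e : GLRackIso X Y) : GLRackIso Y X where
  toEquiv := e.toEquiv.symm
  map_act' a b := e.toEquiv.symm_apply_eq.2 <| by
    simpa using (e.map_act' (e.toEquiv.symm a) (e.toEquiv.symm b)).symm
  map_u' a := e.toEquiv.symm_apply_eq.2 <| by simpa using (e.map_u' (e.toEquiv.symm a)).symm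
  map_d' a := e.toEquiv.symm_apply_eq.2 <| by simpa using (e.map_d' (e.toEquiv.symm a)).symm

end GLRackIso

/-- The value of a word in a GL-rack `Y`, given the values in `Y` of the generators. -/
def GLWord.eval {X Y : Type*} [GLRack Y] (f : X → Y) : GLWord X → Y
  | of x => f x
  | op a b => Shelf.act (b.eval f) (a.eval f)
  | inv a b => Rack.invAct (b.eval f) (a.eval f)
  | u a => GLRack.u (a.eval f)
  | d a => GLRack.d (a.eval f)

theorem GLCongr.eval_eq {X Y : Type*} [GLRack Y] {f : X → Y} {r : GLWord X → GLWord X → Prop}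
    (hf : ∀ a b, r a b → a.eval f = b.eval f) {a b : GLWord X} (h : GLCongr r a b) :
    a.eval f = b.eval f := by
  induction h with
  | rel h => exact hf _ _ h
  | refl => rfl
  | symm _ ih => exact ih.symm
  | trans _ _ ih₁ ih₂ => exact ih₁.trans ih₂
  | op_congr _ _ ih₁ ih₂ => exact congrArg₂ Shelf.act ih₂ ih₁
  | inv_congr _ _ ih₁ ih₂ => exact congrArg₂ Rack.invAct ih₂ ih₁
  | u_congr _ ih => exact congrArg GLRack.u ih
  | d_congr _ ih => exact congrArg GLRack.d ih
  | inv_op a b => exact Rack.left_inv _ _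
  | op_inv a b => exact Rack.right_inv _ _
  | distrib a b c => exact Shelf.self_distrib
  | u_d a => exact GLRack.u_d_act_self _
  | d_u a => exact GLRack.d_u_act_self _
  | u_op a b => exact GLRack.u_act _ _
  | d_op a b => exact GLRack.d_act _ _
  | op_u a b => exact GLRack.act_u _ _
  | op_d a b => exact GLRack.act_d _ _

namespace PresentedGLRack

variable {X Y : Type*} [GLRack Y] {r : GLWord X → GLWord X → Prop}

/-- The element of a presented GL-rack represented by a word. -/
def mk (r : GLWord X → GLWord X → Prop) (a : GLWord X) : PresentedGLRack r :=
  Quotient.mk (glSetoid r) a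

theorem mk_eq_mk {a b : GLWord X} (h : r a b) : mk r a = mk r b :=
  Quotient.sound (s := glSetoid r) (.rel h)

/-- The homomorphism from a presented GL-rack that extends a map on the generators compatible
with the relations. -/
def lift (f : X → Y) (hf : ∀ a b, r a b → a.eval f = b.eval f) :
    GLRackHom (PresentedGLRack r) Y where
  toFun := Quotient.lift (GLWord.eval f) fun _ _ h => GLCongr.eval_eq hf h
  map_act' := by rintro ⟨a⟩ ⟨b⟩; rfl
  map_u' := by rintro ⟨a⟩; rfl
  map_d' := by rintro ⟨a⟩; rfl

theorem eval_map_of (φ : GLRackHom (PresentedGLRack r) Y) (a : GLWord X) :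
    a.eval (fun x => φ (mk r (.of x))) = φ (mk r a) := by
  induction a with
  | of x => rfl
  | op a b ih₁ ih₂ => rw [GLWord.eval, ih₁, ih₂, ← φ.map_act]; rfl
  | inv a b ih₁ ih₂ => rw [GLWord.eval, ih₁, ih₂, ← φ.map_invAct]; rfl
  | u a ih => rw [GLWord.eval, ih, ← φ.map_u]; rfl
  | d a ih => rw [GLWord.eval, ih, ← φ.map_d]; rfl

theorem nonempty_hom_iff :
    Nonempty (GLRackHom (PresentedGLRack r) Y) ↔
      ∃ f : X → Y, ∀ a b, r a b → a.eval f = b.eval f := by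
  refine ⟨fun ⟨φ⟩ => ⟨fun x => φ (mk r (.of x)), fun a b h => ?_⟩, fun ⟨f, hf⟩ => ⟨lift f hf⟩⟩
  rw [eval_map_of, eval_map_of, mk_eq_mk h]

end PresentedGLRack

/-- The translation GL-rack of an abelian group `A` and `p, q : A`: it is `A`, on which `u` and
`d` are the translations by `p` and `q`, and `x * y = x - (p + q)`, as `ud(x * x) = x` demands. -/
def TranslationGLRack {A : Type*} [AddCommGroup A] (_p _q : A) : Type _ := A

namespace TranslationGLRack

variable {A : Type*} [AddCommGroup A] (p q : A)

instance : GLRack (TranslationGLRack p q) where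
  act _ (x : A) := x - (p + q)
  invAct _ (x : A) := x + (p + q)
  u (x : A) := x + p
  d (x : A) := x + q
  self_distrib := rfl
  left_inv _ _ := sub_add_cancel (G := A) _ _
  right_inv _ _ := add_sub_cancel_right (G := A) _ _
  u_d_act_self (x : A) := show x - (p + q) + q + p = x by abel
  d_u_act_self (x : A) := show x - (p + q) + p + q = x by abel
  u_act (x _ : A) := show x - (p + q) + p = x + p - (p + q) by abel
  d_act (x _ : A) := show x - (p + q) + q = x + q - (p + q) by abel
  act_u _ _ := rfl
  act_d _ _ := rfl

end TranslationGLRack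

/-! ### Functions of period one -/

theorem apply_add_intCast_of_periodic {α : Type*} {f : ℝ → α} (hf : Function.Periodic f 1)
    (t : ℝ) (n : ℤ) : f (t + n) = f t := by
  simpa only [mul_one] using hf.int_mul n t

theorem apply_fract_of_periodic {α : Type*} {f : ℝ → α} (hf : Function.Periodic f 1) (t : ℝ) :
    f (Int.fract t) = f t := by
  simpa only [mul_one, Int.self_sub_floor] using hf.sub_int_mul_eq ⌊t⌋ (x := t)

theorem periodic_deriv {𝕜 E : Type*} [NontriviallyNormedField 𝕜] [NormedAddCommGroup E]
    [NormedSpace 𝕜 E] {f : 𝕜 → E} {c : 𝕜} (hf : Function.Periodic f c) :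
    Function.Periodic (deriv f) c := fun t => by
  rw [← deriv_comp_add_const, hf.funext]

theorem ceil_sub_eq_floor_sub_add_one {b t : ℝ} (hb : b ∈ Set.Ico (0 : ℝ) 1)
    (h : b ≠ Int.fract t) : ⌈t - b⌉ = ⌊t - b⌋ + 1 := by
  refine (Int.ceil_eq_floor_add_one_iff_notMem _).2 ?_
  rintro ⟨n, hn⟩
  exact h (by rw [← Int.fract_eq_self.2 hb, eq_add_of_sub_eq' hn.symm, Int.fract_add_intCast])

/-! ### Step functions with prescribed jumps -/

/-- `g` is a left-continuous step function that jumps by `w t` at each time `t`. -/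
structure HasJumps {A : Type*} [AddCommGroup A] (g w : ℝ → A) : Prop where
  eventually_left : ∀ t, ∀ᶠ s in 𝓝[<] t, g s = g t
  eventually_right : ∀ t, ∀ᶠ s in 𝓝[>] t, g s = g t + w t

namespace HasJumps

variable {A : Type*} [AddCommGroup A] {g g' w w' : ℝ → A}

theorem sub (h : HasJumps g w) (h' : HasJumps g' w') : HasJumps (g - g') (w - w') where
  eventually_left t := by
    filter_upwards [h.eventually_left t, h'.eventually_left t] with s hs hs'
    rw [Pi.sub_apply, Pi.sub_apply, hs, hs']
  eventually_right t := by
    filter_upwards [h.eventually_right t, h'.eventually_right t] with s hs hs'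
    rw [Pi.sub_apply, Pi.sub_apply, Pi.sub_apply, hs, hs', add_sub_add_comm]

theorem sum {ι : Type*} {S : Finset ι} {g w : ι → ℝ → A} (h : ∀ i ∈ S, HasJumps (g i) (w i)) :
    HasJumps (∑ i ∈ S, g i) (∑ i ∈ S, w i) where
  eventually_left t := by
    filter_upwards [(Filter.eventually_all_finset S).2 fun i hi => (h i hi).eventually_left t]
      with s hs
    simpa only [Finset.sum_apply] using Finset.sum_congr rfl hs
  eventually_right t := by
    filter_upwards [(Filter.eventually_all_finset S).2 fun i hi => (h i hi).eventually_right t]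
      with s hs
    simpa only [Finset.sum_apply, ← Finset.sum_add_distrib] using Finset.sum_congr rfl hs

theorem ceil_sub_smul (b : ℝ) (a : A) :
    HasJumps (fun t => ⌈t - b⌉ • a) (fun t => (⌊t - b⌋ + 1 - ⌈t - b⌉) • a) where
  eventually_left t := by
    have hb : Filter.Tendsto (· - b) (𝓝[<] t) (𝓝[≤] (t - b)) :=
      (continuous_sub_right b).continuousWithinAt.tendsto_nhdsWithin
        fun _ hs => sub_le_sub_right hs.le b
    filter_upwards [Filter.tendsto_pure.1 ((tendsto_ceil_left_pure_ceil (t - b)).comp hb)]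
      with s hs
    exact congrArg (· • a) hs
  eventually_right t := by
    have hb : Filter.Tendsto (· - b) (𝓝[>] t) (𝓝[>] (t - b)) :=
      (continuous_sub_right b).continuousWithinAt.tendsto_nhdsWithin
        fun _ hs => sub_lt_sub_right hs b
    filter_upwards [Filter.tendsto_pure.1 ((tendsto_ceil_right_pure_floor_add_one (t - b)).comp hb)]
      with s hs
    rw [← add_smul, add_sub_cancel]
    exact congrArg (· • a) hs

theorem eventually_nhds_eq (h : HasJumps g w) {t : ℝ} (ht : w t = 0) :
    ∀ᶠ s in 𝓝 t, g s = g t := by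
  rw [← nhdsNE_sup_pure t, ← nhdsLT_sup_nhdsGT, Filter.eventually_sup, Filter.eventually_sup]
  exact ⟨⟨h.eventually_left t, by simpa only [ht, add_zero] using h.eventually_right t⟩,
    Filter.eventually_pure.2 rfl⟩

theorem apply_eq_of_isPreconnected (h : HasJumps g w) {S : Set ℝ} (hS : IsPreconnected S)
    (hw : ∀ r ∈ S, w r = 0) {s t : ℝ} (hs : s ∈ S) (ht : t ∈ S) : g s = g t := by
  let _ : TopologicalSpace A := ⊥
  have : DiscreteTopology A := ⟨rfl⟩
  refine hS.constant (fun r hr => ContinuousAt.continuousWithinAt ?_) hs ht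
  rw [ContinuousAt, nhds_discrete A, Filter.tendsto_pure]
  exact h.eventually_nhds_eq (hw r hr)

end HasJumps

section Periodic

variable {A : Type*} [AddCommGroup A] {w : ℝ → A}

theorem sum_floor_sub_ceil_smul (hw : Function.Periodic w 1) {S : Finset ℝ}
    (hS : ↑S = Set.Ico 0 1 ∩ Function.support w) (t : ℝ) :
    ∑ b ∈ S, (⌊t - b⌋ + 1 - ⌈t - b⌉) • w b = w t := by
  have hmem {b : ℝ} : b ∈ S ↔ b ∈ Set.Ico (0 : ℝ) 1 ∧ w b ≠ 0 := Set.ext_iff.1 hS b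
  rw [Finset.sum_eq_single (Int.fract t)]
  · simp [Int.self_sub_fract, apply_fract_of_periodic hw]
  · intro b hb hne
    rw [ceil_sub_eq_floor_sub_add_one (hmem.1 hb).1 hne, sub_self, zero_smul]
  · intro ht
    rw [not_not.1 fun h0 => ht (hmem.2 ⟨⟨Int.fract_nonneg t, Int.fract_lt_one t⟩, h0⟩), smul_zero]

theorem exists_hasJumps (hw : Function.Periodic w 1)
    (hfin : (Set.Ico 0 1 ∩ Function.support w).Finite) :
    ∃ g, HasJumps g w ∧ ∀ t, g (t + 1) = g t + ∑ᶠ b ∈ Set.Ico 0 1, w b := by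
  refine ⟨∑ b ∈ hfin.toFinset, fun t => ⌈t - b⌉ • w b, ?_, fun t => ?_⟩
  · convert HasJumps.sum (S := hfin.toFinset) fun b _ => HasJumps.ceil_sub_smul b (w b)
    ext t
    rw [Finset.sum_apply, sum_floor_sub_ceil_smul hw hfin.coe_toFinset]
  · rw [finsum_mem_eq_sum w hfin, Finset.sum_apply, Finset.sum_apply, ← Finset.sum_add_distrib]
    refine Finset.sum_congr rfl fun b _ => ?_
    rw [add_sub_right_comm, Int.ceil_add_one, add_smul, one_smul]

theorem exists_periodic_hasJumps_iff (hw : Function.Periodic w 1)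
    (hfin : (Set.Ico 0 1 ∩ Function.support w).Finite) :
    (∃ g, Function.Periodic g 1 ∧ HasJumps g w) ↔ ∑ᶠ t ∈ Set.Ico 0 1, w t = 0 := by
  obtain ⟨g, hg, hg1⟩ := exists_hasJumps hw hfin
  refine ⟨fun ⟨f, hf1, hf⟩ => ?_, fun h0 => ⟨g, fun t => by rw [hg1, h0, add_zero], hg⟩⟩
  have hconst : (g - f) (0 + 1) = (g - f) 0 :=
    (hg.sub hf).apply_eq_of_isPreconnected isPreconnected_univ (fun _ _ => sub_self _)
      trivial trivial
  simpa only [Pi.sub_apply, hg1, hf1 0, sub_left_inj, add_eq_left] using hconst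

end Periodic

/-! ### Local injectivity -/

theorem exists_injOn_nhds_of_hasStrictDerivAt {𝕜 : Type*} [NontriviallyNormedField 𝕜]
    [CompleteSpace 𝕜] {f : 𝕜 → 𝕜} {f' a : 𝕜} (hf : HasStrictDerivAt f f' a) (hf' : f' ≠ 0) :
    ∃ U ∈ 𝓝 a, Set.InjOn f U :=
  ⟨_, hf.eventually_left_inverse hf', fun s hs t ht h => by rw [← hs, h, ht]⟩

theorem eventually_ne_of_linearIndependent {E : Type*} [NormedAddCommGroup E] [NormedSpace ℝ E]
    {γ δ : ℝ → E} {v w : E} {t₀ s₀ : ℝ} (hγ : HasDerivAt γ v t₀) (hδ : HasDerivAt δ w s₀)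
    (hvw : LinearIndependent ℝ ![v, w]) : ∀ᶠ p in 𝓝[≠] (t₀, s₀), γ p.1 ≠ δ p.2 := by
  have hderiv := (HasFDerivAt.comp (t₀, s₀) (f := Prod.fst) hγ.hasFDerivAt hasFDerivAt_fst).sub
    (HasFDerivAt.comp (t₀, s₀) (f := Prod.snd) hδ.hasFDerivAt hasFDerivAt_snd)
  have hker : LinearMap.ker ((ContinuousLinearMap.toSpanSingleton ℝ v).comp (.fst ℝ ℝ ℝ) -
      (ContinuousLinearMap.toSpanSingleton ℝ w).comp (.snd ℝ ℝ ℝ)).toLinearMap = ⊥ := by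
    refine LinearMap.ker_eq_bot'.2 fun ⟨a, b⟩ hab => ?_
    obtain ⟨ha, hb⟩ := hvw.eq_zero_of_pair' (s := a) (t := b) (by simpa [sub_eq_zero] using hab)
    rw [ha, hb, Prod.mk_zero_zero]
  obtain ⟨C, -, hC⟩ := LinearMap.exists_antilipschitzWith _ hker
  filter_upwards [hderiv.eventually_ne (c := 0) ⟨C, hC⟩] with p hp
  exact sub_ne_zero.1 hp

section LegendrianArc

variable {x y z x' : ℝ → ℝ} {s t : ℝ}

theorem exists_chord_slope_eq (hst : s < t) (hx : ∀ r ∈ Set.Icc s t, HasDerivAt x (x' r) r)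
    (hz : ∀ r ∈ Set.Icc s t, HasDerivAt z (y r * x' r) r) (h0 : ∀ r ∈ Set.Ioo s t, x' r ≠ 0) :
    ∃ r ∈ Set.Ioo s t, z t - z s = y r * (x t - x s) := by
  obtain ⟨r, hr, h⟩ := exists_ratio_hasDerivAt_eq_ratio_slope x x' hst
    (HasDerivAt.continuousOn hx) (fun r hr => hx r (Set.Ioo_subset_Icc_self hr)) z
    (fun r => y r * x' r) (HasDerivAt.continuousOn hz)
    (fun r hr => hz r (Set.Ioo_subset_Icc_self hr))
  exact ⟨r, hr, mul_right_cancel₀ (h0 r hr) (by linear_combination h)⟩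

/-- If the endpoints of a Legendrian arc had the same front, then by Rolle's theorem `x' c = 0` at
some time `c` in between, and the two chords from there to the common endpoint would be parallel to
tangents of the distinct slopes `y α ≠ y β` with `α < c < β`. -/
theorem front_ne_of_injOn (hst : s < t) (hx : ∀ r ∈ Set.Icc s t, HasDerivAt x (x' r) r)
    (hz : ∀ r ∈ Set.Icc s t, HasDerivAt z (y r * x' r) r) (hx' : Set.InjOn x' (Set.Icc s t))
    (hy : Set.InjOn y (Set.Icc s t)) : (x s, z s) ≠ (x t, z t) := by
  intro heq
  obtain ⟨hxst, hzst⟩ := Prod.mk.inj heq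
  obtain ⟨c, hc, hc0⟩ := exists_hasDerivAt_eq_zero hst (HasDerivAt.continuousOn hx) hxst
    fun r hr => hx r (Set.Ioo_subset_Icc_self hr)
  have hsc : Set.Icc s c ⊆ Set.Icc s t := Set.Icc_subset_Icc_right hc.2.le
  have hct : Set.Icc c t ⊆ Set.Icc s t := Set.Icc_subset_Icc_left hc.1.le
  have hne {r : ℝ} (hr : r ∈ Set.Icc s t) (hrc : r ≠ c) : x' r ≠ 0 := fun h =>
    hrc (hx' hr (Set.Ioo_subset_Icc_self hc) (h.trans hc0.symm))
  have hne_left (r : ℝ) (hr : r ∈ Set.Ioo s c) : x' r ≠ 0 :=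
    hne (hsc (Set.Ioo_subset_Icc_self hr)) hr.2.ne
  obtain ⟨α, hα, hzα⟩ := exists_chord_slope_eq hc.1 (fun r hr => hx r (hsc hr))
    (fun r hr => hz r (hsc hr)) hne_left
  obtain ⟨β, hβ, hzβ⟩ := exists_chord_slope_eq hc.2 (fun r hr => hx r (hct hr))
    (fun r hr => hz r (hct hr)) fun r hr => hne (hct (Set.Ioo_subset_Icc_self hr)) hr.1.ne'
  have hαβ : y α ≠ y β := fun h => (hα.2.trans hβ.1).ne
    (hy (hsc (Set.Ioo_subset_Icc_self hα)) (hct (Set.Ioo_subset_Icc_self hβ)) h)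
  have hxsc : x s = x c := by
    refine (sub_eq_zero.1 ((mul_eq_zero.1 ?_).resolve_left (sub_ne_zero.2 hαβ))).symm
    linear_combination -hzst - hzα - hzβ + y β * hxst
  obtain ⟨r, hr, hr0⟩ := exists_hasDerivAt_eq_zero hc.1
    (HasDerivAt.continuousOn fun r hr => hx r (hsc hr)) hxsc
    fun r hr => hx r (hsc (Set.Ioo_subset_Icc_self hr))
  exact hne_left r hr hr0

end LegendrianArc

/-! ### Generic fronts -/

namespace LegendrianKnot

section Front

variable (K : LegendrianKnot)

/-- The front projection of the knot to the `(x, z)`-plane. -/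
def front (t : ℝ) : ℝ × ℝ := (K.x t, K.z t)

theorem periodic_front : Function.Periodic K.front 1 := fun t =>
  Prod.ext (K.periodic_x t) (K.periodic_z t)

theorem periodic_isCusp : Function.Periodic K.IsCusp 1 := fun t => by
  rw [IsCusp, IsCusp, periodic_deriv K.periodic_x]

theorem periodic_isUpCusp : Function.Periodic K.IsUpCusp 1 := fun t => by
  rw [IsUpCusp, IsUpCusp, K.periodic_isCusp, periodic_deriv K.periodic_y,
    periodic_deriv (periodic_deriv K.periodic_x)]

theorem periodic_isDownCusp : Function.Periodic K.IsDownCusp 1 := fun t => by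
  rw [IsDownCusp, IsDownCusp, K.periodic_isCusp, periodic_deriv K.periodic_y,
    periodic_deriv (periodic_deriv K.periodic_x)]

theorem periodic_passesUnder : Function.Periodic K.PassesUnder 1 := fun t => by
  ext s
  rw [PassesUnder, PassesUnder, K.periodic_x, K.periodic_y, K.periodic_z]

theorem periodic_passesUnder_right (t : ℝ) : Function.Periodic (K.PassesUnder t) 1 := fun s => by
  rw [PassesUnder, PassesUnder, K.periodic_x, K.periodic_y, K.periodic_z]

theorem periodic_mem_breaks : Function.Periodic (· ∈ K.breaks) 1 := fun t => by
  simp only [breaks, Set.mem_ofPred_eq, K.periodic_isCusp t, K.periodic_passesUnder t]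

theorem periodic_velocityCross : Function.Periodic K.velocityCross 1 := fun t => by
  ext s
  rw [velocityCross, velocityCross, periodic_deriv K.periodic_x, periodic_deriv K.periodic_z]

theorem periodic_velocityCross_right (t : ℝ) : Function.Periodic (K.velocityCross t) 1 :=
  fun s => by
    rw [velocityCross, velocityCross, periodic_deriv K.periodic_x, periodic_deriv K.periodic_z]

theorem contDiff_deriv_x : ContDiff ℝ ∞ (deriv K.x) :=
  (contDiff_infty_iff_deriv.1 K.smooth_x).2

theorem hasStrictDerivAt_x (t : ℝ) : HasStrictDerivAt K.x (deriv K.x t) t :=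
  K.smooth_x.contDiffAt.hasStrictDerivAt (by simp)

theorem hasStrictDerivAt_y (t : ℝ) : HasStrictDerivAt K.y (deriv K.y t) t :=
  K.smooth_y.contDiffAt.hasStrictDerivAt (by simp)

theorem hasStrictDerivAt_deriv_x (t : ℝ) :
    HasStrictDerivAt (deriv K.x) (deriv (deriv K.x) t) t :=
  K.contDiff_deriv_x.contDiffAt.hasStrictDerivAt (by simp)

theorem hasDerivAt_z (t : ℝ) : HasDerivAt K.z (K.y t * deriv K.x t) t :=
  K.legendrian t ▸ (K.smooth_z.differentiable (by simp) t).hasDerivAt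

theorem hasDerivAt_front (t : ℝ) :
    HasDerivAt K.front (deriv K.x t, K.y t * deriv K.x t) t :=
  (K.hasStrictDerivAt_x t).hasDerivAt.prodMk (K.hasDerivAt_z t)

theorem continuous_front : Continuous K.front :=
  K.smooth_x.continuous.prodMk K.smooth_z.continuous

end Front

variable {K : LegendrianKnot} {s t : ℝ}

theorem IsCusp.deriv_y_ne_zero (h : K.IsCusp t) : deriv K.y t ≠ 0 := fun hy =>
  K.immersed t ⟨h, hy, by rw [K.legendrian, show deriv K.x t = 0 from h, mul_zero]⟩

theorem exists_injOn_front_nhds_of_not_isCusp (h : ¬ K.IsCusp t) :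
    ∃ U ∈ 𝓝 t, Set.InjOn K.front U :=
  (exists_injOn_nhds_of_hasStrictDerivAt (K.hasStrictDerivAt_x t) h).imp fun _ hU =>
    hU.imp_right fun hinj _ hr _ hs hrs => hinj hr hs (congrArg Prod.fst hrs)

theorem IsCusp.exists_injOn_front_nhds (h : K.IsCusp t) (h' : deriv (deriv K.x) t ≠ 0) :
    ∃ U ∈ 𝓝 t, Set.InjOn K.front U := by
  obtain ⟨V, hV, hxV⟩ := exists_injOn_nhds_of_hasStrictDerivAt (K.hasStrictDerivAt_deriv_x t) h'
  obtain ⟨W, hW, hyW⟩ :=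
    exists_injOn_nhds_of_hasStrictDerivAt (K.hasStrictDerivAt_y t) h.deriv_y_ne_zero
  obtain ⟨ε, hε, hball⟩ := Metric.mem_nhds_iff.1 (Filter.inter_mem hV hW)
  have hne {a b : ℝ} (ha : a ∈ Metric.ball t ε) (hb : b ∈ Metric.ball t ε) (hab : a < b) :
      K.front a ≠ K.front b := by
    have hsub := ((convex_ball t ε).ordConnected.out ha hb).trans hball
    exact front_ne_of_injOn hab (fun r _ => (K.hasStrictDerivAt_x r).hasDerivAt)
      (fun r _ => K.hasDerivAt_z r) (hxV.mono fun r hr => (hsub hr).1)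
      (hyW.mono fun r hr => (hsub hr).2)
  refine ⟨_, Metric.ball_mem_nhds t hε, fun a ha b hb hab => ?_⟩
  by_contra hne'
  rcases lt_or_gt_of_ne hne' with hlt | hlt
  · exact hne ha hb hlt hab
  · exact hne hb ha hlt hab.symm

theorem PassesUnder.front_eq (h : K.PassesUnder t s) : K.front t = K.front s :=
  Prod.ext h.1 h.2.1

theorem PassesUnder.ne_add_intCast (h : K.PassesUnder t s) (n : ℤ) : t ≠ s + n := by
  rintro rfl
  exact h.2.2.ne (apply_add_intCast_of_periodic K.periodic_y s n).symm

theorem PassesUnder.ne_add_intCast' (h : K.PassesUnder t s) (n : ℤ) : s ≠ t + n := by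
  rintro rfl
  exact h.2.2.ne (apply_add_intCast_of_periodic K.periodic_y t n)

theorem PassesUnder.fract (h : K.PassesUnder t s) : K.PassesUnder t (Int.fract s) := by
  rwa [apply_fract_of_periodic (K.periodic_passesUnder_right t)]

theorem PassesUnder.mem_breaks (h : K.PassesUnder t s) : t ∈ K.breaks := .inr ⟨s, h⟩

theorem velocityCross_eq (t s : ℝ) :
    K.velocityCross t s = deriv K.x s * deriv K.x t * (K.y t - K.y s) := by
  rw [velocityCross, K.legendrian, K.legendrian]
  ring

theorem linearIndependent_of_velocityCross_ne_zero (h : K.velocityCross t s ≠ 0) :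
    LinearIndependent ℝ
      ![(deriv K.x t, K.y t * deriv K.x t), (deriv K.x s, K.y s * deriv K.x s)] := by
  rw [LinearIndependent.pair_iff]
  intro a b hab
  have hx : a * deriv K.x t + b * deriv K.x s = 0 := congrArg Prod.fst hab
  have hz : a * (K.y t * deriv K.x t) + b * (K.y s * deriv K.x s) = 0 := congrArg Prod.snd hab
  rw [velocityCross_eq] at h
  constructor
  · exact (mul_eq_zero.1 (by linear_combination deriv K.x s * (hz - K.y s * hx) :
      a * (deriv K.x s * deriv K.x t * (K.y t - K.y s)) = 0)).resolve_right h
  · exact (mul_eq_zero.1 (by linear_combination deriv K.x t * (K.y t * hx - hz) :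
      b * (deriv K.x s * deriv K.x t * (K.y t - K.y s)) = 0)).resolve_right h

namespace HasGenericFront

theorem exists_injOn_front_nhds (hK : K.HasGenericFront) (t : ℝ) :
    ∃ U ∈ 𝓝 t, Set.InjOn K.front U := by
  by_cases h : K.IsCusp t
  · exact h.exists_injOn_front_nhds (hK.cusp_nondegenerate t h)
  · exact exists_injOn_front_nhds_of_not_isCusp h

theorem not_isCusp_of_front_eq (hK : K.HasGenericFront) (h : K.front s = K.front t)
    (hst : ∀ n : ℤ, s ≠ t + n) : ¬ K.IsCusp t := fun hc =>
  not_exists.2 hst (hK.cusp_not_double s t hc (congrArg Prod.fst h) (congrArg Prod.snd h))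

theorem velocityCross_ne_zero_of_front_eq (hK : K.HasGenericFront) (h : K.front t = K.front s)
    (hts : ∀ n : ℤ, t ≠ s + n) : K.velocityCross t s ≠ 0 := by
  have hst (n : ℤ) : s ≠ t + n := fun hn => hts (-n) (by rw [hn]; simp)
  have hy : K.y t ≠ K.y s := fun hy =>
    not_exists.2 hts (K.injective t s (congrArg Prod.fst h) hy (congrArg Prod.snd h))
  rw [velocityCross_eq]
  exact mul_ne_zero (mul_ne_zero (hK.not_isCusp_of_front_eq h hts)
    (hK.not_isCusp_of_front_eq h.symm hst)) (sub_ne_zero.2 hy)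

theorem velocityCross_ne_zero (hK : K.HasGenericFront) (h : K.PassesUnder t s) :
    K.velocityCross t s ≠ 0 :=
  hK.velocityCross_ne_zero_of_front_eq h.front_eq h.ne_add_intCast

theorem not_isCusp_under (hK : K.HasGenericFront) (h : K.PassesUnder t s) : ¬ K.IsCusp t :=
  hK.not_isCusp_of_front_eq h.front_eq.symm h.ne_add_intCast'

theorem over_notMem_breaks (hK : K.HasGenericFront) (h : K.PassesUnder t s) : s ∉ K.breaks := by
  rintro (hc | ⟨r, hr⟩)
  · exact hK.not_isCusp_of_front_eq h.front_eq h.ne_add_intCast hc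
  · rcases hK.no_triple t s r h.1 h.2.1 hr.1 hr.2.1 with ⟨n, hn⟩ | ⟨n, hn⟩ | ⟨n, rfl⟩
    · exact h.ne_add_intCast n hn
    · exact hr.ne_add_intCast n hn
    · rw [apply_add_intCast_of_periodic K.periodic_passesUnder] at h
      exact lt_asymm h.2.2 hr.2.2

theorem exists_over_eq_add_intCast (hK : K.HasGenericFront) {s' : ℝ} (h : K.PassesUnder t s)
    (h' : K.PassesUnder t s') : ∃ n : ℤ, s = s' + n := by
  rcases hK.no_triple s t s' h.1.symm h.2.1.symm h'.1 h'.2.1 with ⟨n, hn⟩ | ⟨n, hn⟩ | hn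
  · exact absurd hn (h.ne_add_intCast' n)
  · exact absurd hn (h'.ne_add_intCast n)
  · exact hn

theorem eventually_not_passesUnder_nhds_diagonal (hK : K.HasGenericFront) (t : ℝ) (n : ℤ) :
    ∀ᶠ p in 𝓝 (t, t + n), ¬ K.PassesUnder p.1 p.2 := by
  obtain ⟨U, hU, hinj⟩ := hK.exists_injOn_front_nhds t
  have hfst : Filter.Tendsto Prod.fst (𝓝 (t, t + (n : ℝ))) (𝓝 t) := continuousAt_fst
  have hsnd : Filter.Tendsto (fun p : ℝ × ℝ => p.2 - n) (𝓝 (t, t + (n : ℝ))) (𝓝 t) :=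
    Continuous.tendsto' (by fun_prop) _ _ (add_sub_cancel_right t _)
  filter_upwards [hfst hU, hsnd hU] with p hp₁ hp₂ h
  have hfront : K.front p.1 = K.front (p.2 - n) := by
    rw [h.front_eq, ← apply_add_intCast_of_periodic K.periodic_front (p.2 - n) n, sub_add_cancel]
  exact h.ne_add_intCast (-n) (by simpa [sub_eq_add_neg] using hinj hp₁ hp₂ hfront)

theorem eventually_not_passesUnder_nhdsNE (hK : K.HasGenericFront) (t s : ℝ) :
    ∀ᶠ p in 𝓝[≠] (t, s), ¬ K.PassesUnder p.1 p.2 := by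
  by_cases hfront : K.front t = K.front s
  · by_cases hts : ∃ n : ℤ, s = t + n
    · obtain ⟨n, rfl⟩ := hts
      exact (hK.eventually_not_passesUnder_nhds_diagonal t n).filter_mono nhdsWithin_le_nhds
    · have hcross := hK.velocityCross_ne_zero_of_front_eq hfront
        fun n hn => hts ⟨-n, by rw [hn]; simp⟩
      filter_upwards [eventually_ne_of_linearIndependent (K.hasDerivAt_front t)
        (K.hasDerivAt_front s) (linearIndependent_of_velocityCross_ne_zero hcross)] with p hp h
      exact hp h.front_eq
  · have hne : ∀ᶠ p : ℝ × ℝ in 𝓝 (t, s), K.front p.1 ≠ K.front p.2 :=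
      (K.continuous_front.comp continuous_fst).continuousAt.ne_iff_eventually_ne
        (K.continuous_front.comp continuous_snd).continuousAt |>.1 hfront
    exact (hne.filter_mono nhdsWithin_le_nhds).mono fun p hp h => hp h.front_eq

theorem eventually_not_isCusp (hK : K.HasGenericFront) (t : ℝ) :
    ∀ᶠ s in 𝓝[≠] t, ¬ K.IsCusp s := by
  by_cases h : K.IsCusp t
  · exact (K.hasStrictDerivAt_deriv_x t).hasDerivAt.eventually_ne (hK.cusp_nondegenerate t h)
  · exact (K.contDiff_deriv_x.continuous.continuousAt.eventually_ne h).filter_mono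
      nhdsWithin_le_nhds

theorem eventually_notMem_breaks (hK : K.HasGenericFront) (t : ℝ) :
    ∀ᶠ r in 𝓝[≠] t, r ∉ K.breaks := by
  have hunder : ∀ᶠ r in 𝓝 t, ∀ s ∈ Set.Icc (0 : ℝ) 1, r ≠ t → ¬ K.PassesUnder r s := by
    refine isCompact_Icc.eventually_forall_of_forall_eventually fun s _ => ?_
    filter_upwards [eventually_nhdsWithin_iff.1 (hK.eventually_not_passesUnder_nhdsNE t s)]
      with p hp hne
    exact hp fun h => hne (congrArg Prod.fst h)
  filter_upwards [hK.eventually_not_isCusp t, hunder.filter_mono nhdsWithin_le_nhds,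
    self_mem_nhdsWithin] with r hcusp hr hne
  rintro (h | ⟨s, h⟩)
  · exact hcusp h
  · exact hr _ ⟨Int.fract_nonneg s, (Int.fract_lt_one s).le⟩ hne h.fract

theorem finite_breaks (hK : K.HasGenericFront) : (Set.Ico 0 1 ∩ K.breaks).Finite := by
  by_contra h
  obtain ⟨t, -, ht⟩ := Set.Infinite.exists_accPt_of_subset_isCompact h isCompact_Icc
    (Set.inter_subset_left.trans Set.Ico_subset_Icc_self)
  rw [accPt_iff_frequently_nhdsNE] at ht
  exact ht ((hK.eventually_notMem_breaks t).mono fun _ h h' => h h'.2)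

end HasGenericFront

end LegendrianKnot

/-! ### Weights of cusps and crossings -/

theorem finsum_mem_indicator_const {ι M : Type*} [AddCommMonoid M] {s t : Set ι}
    (h : (s ∩ t).Finite) (a : M) :
    ∑ᶠ i ∈ s, t.indicator (fun _ => a) i = (s ∩ t).ncard • a := by
  simp only [finsum_mem_def, Set.indicator_indicator]
  rw [← finsum_mem_def, finsum_mem_eq_finite_toFinset_sum _ h, Finset.sum_const,
    Set.ncard_eq_toFinset_card _ h]

namespace LegendrianKnot

section Weight

variable (K : LegendrianKnot) {A : Type*} [AddCommGroup A] (p q : A)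

/-- The sign of the crossing at which the strand at time `t` is the undercrossing strand, and `0`
if there is no such crossing. The sum has at most one term if the front is generic. -/
noncomputable def crossingSign (t : ℝ) : ℤ :=
  ∑ᶠ s ∈ {s ∈ Set.Ico 0 1 | K.PassesUnder t s}, ↑(SignType.sign (K.velocityCross t s))

/-- The prescribed jump at time `t` of a homomorphism from the fundamental GL-rack to
`TranslationGLRack p q`, seen as a function on the arcs. -/
noncomputable def weight (t : ℝ) : A :=
  {t | K.IsUpCusp t}.indicator (fun _ => p) t + {t | K.IsDownCusp t}.indicator (fun _ => q) t -
    K.crossingSign t • (p + q)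

theorem periodic_crossingSign : Function.Periodic K.crossingSign 1 := fun t => by
  rw [crossingSign, crossingSign, K.periodic_passesUnder, K.periodic_velocityCross]

theorem periodic_weight : Function.Periodic (K.weight p q) 1 := fun t => by
  classical
  simp only [weight, Set.indicator_apply, Set.mem_ofPred_eq, K.periodic_crossingSign t,
    K.periodic_isUpCusp t, K.periodic_isDownCusp t]

end Weight

variable {K : LegendrianKnot} {A : Type*} [AddCommGroup A] {p q : A} {s t : ℝ}

theorem IsUpCusp.not_isDownCusp (h : K.IsUpCusp t) : ¬ K.IsDownCusp t := fun h' =>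
  lt_asymm h.2 h'.2

theorem crossingSign_eq_zero (h : ∀ s, ¬ K.PassesUnder t s) : K.crossingSign t = 0 := by
  simp [crossingSign, h]

theorem weight_eq_zero (h : t ∉ K.breaks) : K.weight p q t = 0 := by
  rw [breaks, Set.mem_ofPred_eq, not_or, not_exists] at h
  simp [weight, IsUpCusp, IsDownCusp, h.1, crossingSign_eq_zero h.2]

theorem finsum_mem_Ico_inter_breaks {f : ℝ → A} (hf : ∀ t ∉ K.breaks, f t = 0) :
    ∑ᶠ t ∈ Set.Ico 0 1 ∩ K.breaks, f t = ∑ᶠ t ∈ Set.Ico 0 1, f t :=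
  finsum_mem_inter_support_eq' _ _ _ fun t ht =>
    and_iff_left (by_contra fun h => ht (hf t h))

namespace HasGenericFront

theorem isUpCusp_or_isDownCusp (hK : K.HasGenericFront) (h : K.IsCusp t) :
    K.IsUpCusp t ∨ K.IsDownCusp t :=
  (mul_ne_zero h.deriv_y_ne_zero (hK.cusp_nondegenerate t h)).lt_or_gt.symm.imp (⟨h, ·⟩) (⟨h, ·⟩)

theorem crossingSign_eq (hK : K.HasGenericFront) (h : K.PassesUnder t s) :
    K.crossingSign t = SignType.sign (K.velocityCross t s) := by
  have hset : {r ∈ Set.Ico 0 1 | K.PassesUnder t r} = {Int.fract s} := by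
    ext r
    refine ⟨fun ⟨hr, hr'⟩ => ?_, ?_⟩
    · obtain ⟨n, rfl⟩ := hK.exists_over_eq_add_intCast h hr'
      rw [Int.fract_add_intCast, Int.fract_eq_self.2 hr, Set.mem_singleton_iff]
    · rintro rfl
      exact ⟨⟨Int.fract_nonneg s, Int.fract_lt_one s⟩, h.fract⟩
  rw [crossingSign, hset, finsum_mem_singleton,
    apply_fract_of_periodic (K.periodic_velocityCross_right t)]

theorem weight_upCusp (hK : K.HasGenericFront) (h : K.IsUpCusp t) : K.weight p q t = p := by
  simp [weight, h, h.not_isDownCusp,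
    crossingSign_eq_zero fun s hs => hK.not_isCusp_under (s := s) hs h.1]

theorem weight_downCusp (hK : K.HasGenericFront) (h : K.IsDownCusp t) : K.weight p q t = q := by
  simp [weight, h, imp_not_comm.1 IsUpCusp.not_isDownCusp h,
    crossingSign_eq_zero fun s hs => hK.not_isCusp_under (s := s) hs h.1]

theorem weight_posCrossing (hK : K.HasGenericFront) (h : K.PassesUnder t s)
    (hpos : 0 < K.velocityCross t s) : K.weight p q t = -(p + q) := by
  simp [weight, IsUpCusp, IsDownCusp, hK.not_isCusp_under h, hK.crossingSign_eq h, hpos]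

theorem weight_negCrossing (hK : K.HasGenericFront) (h : K.PassesUnder t s)
    (hneg : K.velocityCross t s < 0) : K.weight p q t = p + q := by
  simp [weight, IsUpCusp, IsDownCusp, hK.not_isCusp_under h, hK.crossingSign_eq h, hneg, add_comm]

theorem finite_cusps (hK : K.HasGenericFront) {P : ℝ → Prop} (hP : ∀ t, P t → K.IsCusp t) :
    {t ∈ Set.Ico (0 : ℝ) 1 | P t}.Finite :=
  hK.finite_breaks.subset fun t ht => ⟨ht.1, .inl (hP t ht.2)⟩

theorem finsum_indicator_cusps (hK : K.HasGenericFront) {P : ℝ → Prop}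
    (hP : ∀ t, P t → K.IsCusp t) (a : A) :
    ∑ᶠ t ∈ Set.Ico 0 1 ∩ K.breaks, {t | P t}.indicator (fun _ => a) t =
      {t ∈ Set.Ico (0 : ℝ) 1 | P t}.ncard • a := by
  rw [finsum_mem_Ico_inter_breaks fun t ht =>
    Set.indicator_of_notMem (s := {t | P t}) (fun h => ht (.inl (hP t h))) _]
  exact finsum_mem_indicator_const (hK.finite_cusps hP) a

theorem numCusps_eq (hK : K.HasGenericFront) :
    K.numCusps = K.numUpCusps + K.numDownCusps := by
  have hunion : {t ∈ Set.Ico (0 : ℝ) 1 | K.IsCusp t} =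
      {t ∈ Set.Ico 0 1 | K.IsUpCusp t} ∪ {t ∈ Set.Ico 0 1 | K.IsDownCusp t} := by
    ext t
    exact ⟨fun ⟨ht, hc⟩ => (hK.isUpCusp_or_isDownCusp hc).imp (⟨ht, ·⟩) (⟨ht, ·⟩),
      fun h => h.elim (fun h => ⟨h.1, h.2.1⟩) fun h => ⟨h.1, h.2.1⟩⟩
  rw [numCusps, hunion, Set.ncard_union_eq
    (Set.disjoint_left.2 fun t h h' => h.2.not_isDownCusp h'.2)
    (hK.finite_cusps fun _ h => h.1) (hK.finite_cusps fun _ h => h.1), numUpCusps, numDownCusps]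

theorem injOn_fst_crossings (hK : K.HasGenericFront) : Set.InjOn Prod.fst K.crossings := by
  rintro ⟨t, s⟩ ⟨-, (hs : s ∈ Set.Ico 0 1), h⟩ ⟨t', s'⟩ ⟨-, (hs' : s' ∈ Set.Ico 0 1), h'⟩
    (rfl : t = t')
  obtain ⟨n, hn : s = s' + n⟩ := hK.exists_over_eq_add_intCast h h'
  rw [← Int.fract_eq_self.2 hs, ← Int.fract_eq_self.2 hs', hn, Int.fract_add_intCast]

theorem finsum_crossingSign (hK : K.HasGenericFront) :
    ∑ᶠ t ∈ Set.Ico 0 1, K.crossingSign t = K.writhe := by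
  have hsupport (t : ℝ) (ht : t ∈ Function.support K.crossingSign) :
      t ∈ Set.Ico 0 1 ↔ t ∈ Prod.fst '' K.crossings := by
    refine ⟨fun h01 => ?_, fun ⟨c, hc, hct⟩ => hct ▸ hc.1⟩
    obtain ⟨s, hs⟩ := not_forall_not.1 (mt crossingSign_eq_zero ht)
    exact ⟨(t, Int.fract s), ⟨h01, ⟨Int.fract_nonneg s, Int.fract_lt_one s⟩, hs.fract⟩, rfl⟩
  rw [finsum_mem_inter_support_eq' _ _ _ hsupport, finsum_mem_image hK.injOn_fst_crossings, writhe]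
  exact finsum_mem_congr rfl fun c hc => hK.crossingSign_eq hc.2.2

theorem finsum_weight (hK : K.HasGenericFront) :
    ∑ᶠ t ∈ Set.Ico 0 1, K.weight p q t =
      ((K.numUpCusps : ℤ) - K.writhe) • p + ((K.numDownCusps : ℤ) - K.writhe) • q := by
  have hup := hK.finsum_indicator_cusps (P := K.IsUpCusp) (fun _ h => h.1) p
  have hdown := hK.finsum_indicator_cusps (P := K.IsDownCusp) (fun _ h => h.1) q
  have hcross : ∑ᶠ t ∈ Set.Ico 0 1 ∩ K.breaks, K.crossingSign t • (p + q) =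
      K.writhe • (p + q) := by
    rw [← hK.finsum_crossingSign, ← finsum_mem_Ico_inter_breaks fun t ht =>
      crossingSign_eq_zero fun s hs => ht hs.mem_breaks]
    exact ((zmultiplesHom A (p + q)).map_finsum_mem _ hK.finite_breaks).symm
  rw [← finsum_mem_Ico_inter_breaks fun t ht => weight_eq_zero ht]
  simp only [weight]
  rw [finsum_mem_sub_distrib _ _ hK.finite_breaks, finsum_mem_add_distrib hK.finite_breaks, hup,
    hdown, hcross, smul_add, sub_smul, sub_smul, natCast_zsmul, natCast_zsmul,
    add_sub_add_comm, numUpCusps, numDownCusps]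

end HasGenericFront

end LegendrianKnot

/-! ### Functions on the arcs -/

namespace LegendrianKnot

variable {K : LegendrianKnot} {A : Type*} [AddCommGroup A] {w : ℝ → A} {f : K.Arc → A}
  {g : ℝ → A} {t : ℝ} {a b : K.Arc}

theorem arc_eq_of_disjoint {s t : {t : ℝ // t ∉ K.breaks}}
    (h : Disjoint (Set.uIcc (s : ℝ) t) K.breaks) : K.arc s = K.arc t :=
  Quot.sound ⟨0, by simpa using h⟩

theorem exists_arc_eq_of_add_one (ht : t ∉ K.breaks) :
    ∃ h : t + 1 ∉ K.breaks, K.arc ⟨t + 1, h⟩ = K.arc ⟨t, ht⟩ := by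
  have h : t + 1 ∉ K.breaks := fun h => ht ((K.periodic_mem_breaks t).mp h)
  exact ⟨h, Quot.sound ⟨1, by simpa using h⟩⟩

theorem ArcBefore.unique (ha : K.ArcBefore t a) (hb : K.ArcBefore t b) : a = b := by
  obtain ⟨s, ⟨_, rfl⟩, _, rfl⟩ := (ha.and hb).exists
  rfl

theorem ArcAfter.unique (ha : K.ArcAfter t a) (hb : K.ArcAfter t b) : a = b := by
  obtain ⟨s, ⟨_, rfl⟩, _, rfl⟩ := (ha.and hb).exists
  rfl

theorem ArcBefore.add_one (ha : K.ArcBefore t a) : K.ArcBefore (t + 1) a := by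
  rw [ArcBefore, ← Filter.map_add_right_nhdsLT, Filter.eventually_map]
  filter_upwards [ha] with s ⟨hs, hsa⟩
  exact hsa ▸ exists_arc_eq_of_add_one hs

theorem exists_eventually_arc_eq {l : Filter ℝ} [l.NeBot]
    [Filter.TendstoIxxClass Set.Icc l l] (h : ∀ᶠ s in l, s ∉ K.breaks) :
    ∃ a, ∀ᶠ s in l, ∃ hs : s ∉ K.breaks, K.arc ⟨s, hs⟩ = a := by
  have huIcc : ∀ᶠ p in l ×ˢ l, Set.uIcc p.1 p.2 ⊆ K.breaksᶜ :=
    Filter.tendsto_smallSets_iff.1 (Filter.tendsto_fst.uIcc Filter.tendsto_snd) _ h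
  obtain ⟨r, hr, hrl⟩ := (h.and huIcc.curry).exists
  refine ⟨K.arc ⟨r, hr⟩, ?_⟩
  filter_upwards [h, hrl] with s hs hrs
  exact ⟨hs, (arc_eq_of_disjoint (s := ⟨r, hr⟩) (Set.disjoint_left.2 fun _ h => hrs h)).symm⟩

/-- The function `f` on the arcs jumps by `w t` at each time `t`. -/
def HasArcJumps (f : K.Arc → A) (w : ℝ → A) : Prop :=
  ∀ t a b, K.ArcBefore t a → K.ArcAfter t b → f b = f a + w t

theorem exists_hasArcJumps (hg : Function.Periodic g 1) (hgw : HasJumps g w)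
    (hw : ∀ t ∉ K.breaks, w t = 0) : ∃ f : K.Arc → A, HasArcJumps f w := by
  have hsame (s t : {t : ℝ // t ∉ K.breaks}) : K.SameArc s t → g s = g t := by
    rintro ⟨n, hn⟩
    rw [← apply_add_intCast_of_periodic hg t n]
    exact hgw.apply_eq_of_isPreconnected isPreconnected_uIcc
      (fun r hr => hw r (Set.disjoint_left.1 hn hr)) Set.left_mem_uIcc Set.right_mem_uIcc
  refine ⟨Quot.lift (fun t => g t) hsame, fun t a b ha hb => ?_⟩
  obtain ⟨r, ⟨_, rfl⟩, hr⟩ := (ha.and (hgw.eventually_left t)).exists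
  obtain ⟨s, ⟨_, rfl⟩, hs⟩ := (hb.and (hgw.eventually_right t)).exists
  change g s = g r + w t
  rw [hr, hs]

namespace HasGenericFront

theorem exists_arcBefore (hK : K.HasGenericFront) (t : ℝ) : ∃ a, K.ArcBefore t a :=
  exists_eventually_arc_eq ((hK.eventually_notMem_breaks t).filter_mono (nhdsLT_le_nhdsNE t))

theorem exists_arcAfter (hK : K.HasGenericFront) (t : ℝ) : ∃ a, K.ArcAfter t a :=
  exists_eventually_arc_eq ((hK.eventually_notMem_breaks t).filter_mono (nhdsGT_le_nhdsNE t))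

theorem eventually_arc_eq (hK : K.HasGenericFront) (ht : t ∉ K.breaks) :
    ∀ᶠ s in 𝓝 t, ∃ hs : s ∉ K.breaks, K.arc ⟨s, hs⟩ = K.arc ⟨t, ht⟩ := by
  have h : ∀ᶠ s in 𝓝 t, s ∉ K.breaks := by
    rw [← nhdsNE_sup_pure t, Filter.eventually_sup]
    exact ⟨hK.eventually_notMem_breaks t, Filter.eventually_pure.2 ht⟩
  obtain ⟨a, ha⟩ := exists_eventually_arc_eq h
  obtain ⟨_, rfl⟩ := ha.self_of_nhds
  exact ha

theorem arcBefore_arc (hK : K.HasGenericFront) (ht : t ∉ K.breaks) :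
    K.ArcBefore t (K.arc ⟨t, ht⟩) :=
  (hK.eventually_arc_eq ht).filter_mono nhdsWithin_le_nhds

theorem arcAfter_arc (hK : K.HasGenericFront) (ht : t ∉ K.breaks) :
    K.ArcAfter t (K.arc ⟨t, ht⟩) :=
  (hK.eventually_arc_eq ht).filter_mono nhdsWithin_le_nhds

theorem exists_periodic_hasJumps (hK : K.HasGenericFront) (hf : HasArcJumps f w) :
    ∃ g, Function.Periodic g 1 ∧ HasJumps g w := by
  choose before hbefore using hK.exists_arcBefore
  have harc {s : ℝ} {a : K.Arc} : (∃ hs : s ∉ K.breaks, K.arc ⟨s, hs⟩ = a) → before s = a := by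
    rintro ⟨hs, rfl⟩
    exact (hbefore s).unique (hK.arcBefore_arc hs)
  refine ⟨fun t => f (before t), fun t => ?_, fun t => ?_, fun t => ?_⟩
  · exact congrArg f ((hbefore (t + 1)).unique (hbefore t).add_one)
  · filter_upwards [hbefore t] with s hs
    rw [harc hs]
  · obtain ⟨b, hb⟩ := hK.exists_arcAfter t
    filter_upwards [hb] with s hs
    rw [harc hs, hf t _ b (hbefore t) hb]

theorem exists_hasArcJumps_iff (hK : K.HasGenericFront) (hw : ∀ t ∉ K.breaks, w t = 0) :
    (∃ f : K.Arc → A, HasArcJumps f w) ↔ ∃ g, Function.Periodic g 1 ∧ HasJumps g w :=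
  ⟨fun ⟨_, hf⟩ => hK.exists_periodic_hasJumps hf,
    fun ⟨_, hg, hgw⟩ => exists_hasArcJumps hg hgw hw⟩

end HasGenericFront

end LegendrianKnot

/-! ### Homomorphisms to translation GL-racks -/

namespace LegendrianKnot

variable {K : LegendrianKnot} {A : Type*} [AddCommGroup A] {p q : A} {f : K.Arc → A}

namespace HasGenericFront

theorem eval_eq_of_hasArcJumps (hK : K.HasGenericFront) (hf : HasArcJumps f (K.weight p q))
    {a b : GLWord K.Arc} (h : K.FrontRel a b) :
    a.eval (Y := TranslationGLRack p q) f = b.eval (Y := TranslationGLRack p q) f := by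
  cases h with
  | upCusp h ha hb => exact (hf _ _ _ ha hb).trans (by rw [hK.weight_upCusp h]; rfl)
  | downCusp h ha hb => exact (hf _ _ _ ha hb).trans (by rw [hK.weight_downCusp h]; rfl)
  | posCrossing _ h hpos ha hb =>
    exact (hf _ _ _ ha hb).trans
      (by rw [hK.weight_posCrossing h hpos, ← sub_eq_add_neg]; rfl)
  | negCrossing _ h hneg ha hb =>
    have hjump := hf _ _ _ ha hb
    rw [hK.weight_negCrossing h hneg] at hjump
    exact eq_sub_of_add_eq (G := A) hjump.symm

theorem hasArcJumps_of_eval_eq (hK : K.HasGenericFront)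
    (hf : ∀ a b, K.FrontRel a b →
      a.eval (Y := TranslationGLRack p q) f = b.eval (Y := TranslationGLRack p q) f) :
    HasArcJumps f (K.weight p q) := by
  intro t a b ha hb
  by_cases ht : t ∈ K.breaks
  · rcases ht with hc | ⟨s, hs⟩
    · rcases hK.isUpCusp_or_isDownCusp hc with h | h
      · rw [hK.weight_upCusp h]
        exact hf _ _ (.upCusp h ha hb)
      · rw [hK.weight_downCusp h]
        exact hf _ _ (.downCusp h ha hb)
    · rcases lt_or_gt_of_ne (hK.velocityCross_ne_zero hs) with h | h
      · rw [hK.weight_negCrossing hs h]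
        exact eq_add_of_sub_eq (G := A)
          (hf _ _ (.negCrossing (hK.over_notMem_breaks hs) hs h ha hb)).symm
      · rw [hK.weight_posCrossing hs h, ← sub_eq_add_neg]
        exact hf _ _ (.posCrossing (hK.over_notMem_breaks hs) hs h ha hb)
  · rw [weight_eq_zero ht, add_zero, ha.unique (hK.arcBefore_arc ht),
      hb.unique (hK.arcAfter_arc ht)]

theorem nonempty_hom_translationGLRack_iff (hK : K.HasGenericFront) :
    Nonempty (GLRackHom (PresentedGLRack K.FrontRel) (TranslationGLRack p q)) ↔
      ((K.numUpCusps : ℤ) - K.writhe) • p + ((K.numDownCusps : ℤ) - K.writhe) • q = 0 := by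
  have hfin : (Set.Ico 0 1 ∩ Function.support (K.weight p q)).Finite :=
    hK.finite_breaks.subset (Set.inter_subset_inter_right _
      (Function.support_subset_iff'.2 fun t ht => weight_eq_zero ht))
  calc Nonempty (GLRackHom (PresentedGLRack K.FrontRel) (TranslationGLRack p q))
      ↔ ∃ f : K.Arc → A, HasArcJumps f (K.weight p q) :=
        PresentedGLRack.nonempty_hom_iff.trans <| exists_congr fun f : K.Arc → A =>
          ⟨hK.hasArcJumps_of_eval_eq (f := f), fun hf _ _ => hK.eval_eq_of_hasArcJumps hf⟩
    _ ↔ ∃ g, Function.Periodic g 1 ∧ HasJumps g (K.weight p q) :=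
        hK.exists_hasArcJumps_iff fun _ => weight_eq_zero
    _ ↔ ∑ᶠ t ∈ Set.Ico 0 1, K.weight p q t = 0 :=
        exists_periodic_hasJumps_iff (K.periodic_weight p q) hfin
    _ ↔ _ := by rw [hK.finsum_weight]

end HasGenericFront

/-- The coefficients of `p` and `q` in the total weight of the front. -/
noncomputable def totalWeight (K : LegendrianKnot) : ℤ × ℤ :=
  ((K.numUpCusps : ℤ) - K.writhe, (K.numDownCusps : ℤ) - K.writhe)

theorem HasGenericFront.nonempty_hom_quotient_iff (hK : K.HasGenericFront)
    (H : AddSubgroup (ℤ × ℤ)) :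
    Nonempty (GLRackHom (PresentedGLRack K.FrontRel)
        (TranslationGLRack (A := (ℤ × ℤ) ⧸ H) (QuotientAddGroup.mk (1, 0))
          (QuotientAddGroup.mk (0, 1)))) ↔ K.totalWeight ∈ H := by
  rw [hK.nonempty_hom_translationGLRack_iff, ← QuotientAddGroup.eq_zero_iff,
    ← QuotientAddGroup.mk_zsmul, ← QuotientAddGroup.mk_zsmul, ← QuotientAddGroup.mk_add]
  simp [totalWeight]

namespace FrontDiagram

variable {K₁ K₂ : LegendrianKnot} {D₁ : K₁.FrontDiagram} {D₂ : K₂.FrontDiagram}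

theorem totalWeight_mem_zmultiples (φ : GLRackHom D₁.GLR D₂.GLR) :
    D₁.knot.totalWeight ∈ AddSubgroup.zmultiples D₂.knot.totalWeight := by
  obtain ⟨ψ⟩ := (D₂.generic.nonempty_hom_quotient_iff _).2
    (AddSubgroup.mem_zmultiples D₂.knot.totalWeight)
  exact (D₁.generic.nonempty_hom_quotient_iff _).1 ⟨ψ.comp φ⟩

theorem totalWeight_fst (D : K.FrontDiagram) :
    (D.knot.totalWeight.1 : ℚ) = -(D.tb + D.rot) := by
  simp only [totalWeight, tb, rot, D.generic.numCusps_eq]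
  push_cast
  ring

theorem totalWeight_snd (D : K.FrontDiagram) :
    (D.knot.totalWeight.2 : ℚ) = -(D.tb - D.rot) := by
  simp only [totalWeight, tb, rot, D.generic.numCusps_eq]
  push_cast
  ring

end FrontDiagram

end LegendrianKnot

theorem eq_or_eq_neg_of_mem_zmultiples {G : Type*} [AddGroup G] [IsAddTorsionFree G] {v w : G}
    (hv : v ∈ AddSubgroup.zmultiples w) (hw : w ∈ AddSubgroup.zmultiples v) :
    v = w ∨ v = -w := by
  obtain rfl | hne := eq_or_ne v 0
  · simpa [eq_comm] using hw
  · rw [← neg_eq_iff_eq_neg, ← AddSubgroup.zmultiples_eq_zmultiples_iff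
      (not_isOfFinAddOrder_of_isAddTorsionFree hne)]
    exact le_antisymm (AddSubgroup.zmultiples_le_of_mem hv) (AddSubgroup.zmultiples_le_of_mem hw)

theorem theorem1_general {K₁ K₂ : LegendrianKnot} {D₁ : K₁.FrontDiagram} {D₂ : K₂.FrontDiagram}
    (φ : GLRackHom D₁.GLR D₂.GLR) (ψ : GLRackHom D₂.GLR D₁.GLR) :
    (D₁.tb = D₂.tb ∧ D₁.rot = D₂.rot) ∨ (D₁.tb = -D₂.tb ∧ D₁.rot = -D₂.rot) := by
  have hfst := D₁.totalWeight_fst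
  have hsnd := D₁.totalWeight_snd
  refine (eq_or_eq_neg_of_mem_zmultiples
    (LegendrianKnot.FrontDiagram.totalWeight_mem_zmultiples φ)
    (LegendrianKnot.FrontDiagram.totalWeight_mem_zmultiples ψ)).imp (fun h => ?_) fun h => ?_
  · rw [h, D₂.totalWeight_fst] at hfst
    rw [h, D₂.totalWeight_snd] at hsnd
    constructor <;> linarith
  · rw [h, Prod.fst_neg, Int.cast_neg, D₂.totalWeight_fst] at hfst
    rw [h, Prod.snd_neg, Int.cast_neg, D₂.totalWeight_snd] at hsnd
    constructor <;> linarith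

theorem theorem1 (K₁ K₂ : LegendrianKnot) (D₁ : K₁.FrontDiagram) (D₂ : K₂.FrontDiagram)
    (h : Nonempty (GLRackIso D₁.GLR D₂.GLR)) :
    (D₁.tb = D₂.tb ∧ D₁.rot = D₂.rot) ∨ (D₁.tb = -D₂.tb ∧ D₁.rot = -D₂.rot) :=
  h.elim fun e => theorem1_general e.toHom e.symm.toHom
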